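/- Let $F$ be $\mathbb R$ or a $p$-adic field (more generally, any field of characteristic $0$), let $\overline F$ be an algebraic closure of $F$, and let $\Gamma=\mathrm{Gal}(\overline F/F)$. Let $G$ be a connected reductive group over $F$ with an $F$-splitting $\mathrm{spl}=(T,B,\{X_\alpha\})$; that is, $B$ is a Borel subgroup of $G$ defined over $F$ (so $G$ is quasi-split), $T\subset B$ is a maximal torus defined over $F$, and $\{X_\alpha\}$ is a $\Gamma$-stable family of nonzero root vectors, one for each simple root $\alpha$ of $(T,B)$. Let $\Omega(T,G)$ be the Weyl group of $T$ and let $c=(c_\alpha)_{\alpha\in R(T,G)}$ be a family of elements of $\overline F^\times$ such that $c_{w\alpha}=c_\alpha$ for $w\in\Omega(T,G)$ and $c_{\sigma\alpha}=\sigma(c_\alpha)$ for $\sigma\in\Gamma$. Let $c\cdot\mathrm{spl}$ be the $F$-splitting $(T,B,\{c_\alpha X_\alpha\})$. Let $S\subset G$ be a maximal torus defined over $F$ and let $A=(a_\beta)_{\beta\in R(S,G)}$ be a set of $a$-data: $a_\beta\in\overline F^\times$, $a_{\sigma\beta}=\sigma(a_\beta)$ for $\sigma\in\Gamma$, and $a_{-\beta}=-a_\beta$.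 Transport $c$ to the family $(c_\beta)_{\beta\in R(S,G)}$ with $c_{\mathrm{Ad}(h)\alpha}=c_\alpha$ for every $\alpha\in R(T,G)$ and every $h\in G(\overline F)$ with $hTh^{-1}=S$ (this does not depend on $h$), and put $c\cdot A=(c_\beta a_\beta)_{\beta\in R(S,G)}$. For an $F$-splitting $\mathrm{spl}=(T,B,\{X_\alpha\})$ and $a$-data $A$ the Langlands--Shelstad splitting invariant $\lambda(S,A,\mathrm{spl})\in H^1(F,S)$ is defined as follows. For a simple root $\alpha$ let $\eta_\alpha:\mathrm{SL}_2\to G$ be the homomorphism determined by $\mathrm{spl}$: it restricts to $\alpha^\vee$ on the diagonal torus, and its differential sends $\begin{pmatrix}0&1\\0&0\end{pmatrix}$ to $X_\alpha$ and $\begin{pmatrix}0&0\\1&0\end{pmatrix}$ into the root space of $-\alpha$. Put $n_{\mathrm{spl}}(s_\alpha)=\eta_\alpha\begin{pmatrix}0&1\\-1&0\end{pmatrix}$ and $n_{\mathrm{spl}}(w)=n_{\mathrm{spl}}(s_{\alpha_1})\cdots n_{\mathrm{spl}}(s_{\alpha_m})$ for a reduced expression $w=s_{\alpha_1}\cdots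 s_{\alpha_m}$ of $w\in\Omega(T,G)$. Choose a Borel subgroup $B_S\supset S$ of $G$ over $\overline F$ and $h\in G(\overline F)$ with $\mathrm{Ad}(h)(T,B)=(S,B_S)$, and for $\sigma\in\Gamma$ let $w_S(\sigma)\in\Omega(T,G)$ be such that $\mathrm{Ad}(h^{-1})({}^\sigma s)={}^{w_S(\sigma)\sigma}(\mathrm{Ad}(h^{-1})s)$ for all $s\in S$. Then $\lambda(S,A,\mathrm{spl})$ is the class whose image under $\mathrm{Ad}(h^{-1})$ is represented by the cocycle $$\sigma\mapsto\prod_{\substack{\alpha\in R(T,G)\\ \alpha>0,\ w_S(\sigma)^{-1}\alpha<0}}\alpha^\vee(a_{\mathrm{Ad}(h)\alpha})\cdot n_{\mathrm{spl}}(w_S(\sigma))\cdot\sigma(h^{-1})h .$$ Then $$\lambda(S,A,c\cdot\mathrm{spl})=\lambda(S,c\cdot A,\mathrm{spl}),$$ that is, a class $x\in H^1(F,S)$ is obtained by this construction from $(S,A,c\cdot\mathrm{spl})$ if and only if it is obtained from $(S,c\cdot A,\mathrm{spl})$. -/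

import Mathlib

open scoped MatrixGroups

noncomputable section

namespace SplInv

/-! ## Linear algebraic groups over a field of characteristic zero

`K` is an algebraic closure of `F`.  A linear algebraic group over `F` is given by its group of
`K`-points, a subgroup of `GL n K` cut out by polynomials with coefficients in `F`; the Galois
group `Gal(K/F)` acts on it through the matrix entries. -/

section Basic

variable {F K : Type*} [Field F] [Field K] [Algebra F K] {n : ℕ}

/-- The Galois action on `GL n K`, entry by entry. -/
def gal (σ : Gal(K/F)) : GL (Fin n) K →* GL (Fin n) K :=
  Matrix.GeneralLinearGroup.map (σ : K →+* K)

/-- The Galois action on matrices, entry by entry. -/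
def galMat (σ : Gal(K/F)) (X : Matrix (Fin n) (Fin n) K) : Matrix (Fin n) (Fin n) K :=
  X.map σ

/-- The matrix entries of `g`, as a point at which polynomials can be evaluated. -/
def entries {R : Type*} (g : Matrix (Fin n) (Fin n) R) : Fin n × Fin n → R := fun ij => g ij.1 ij.2

/-- Zariski closed subsets of `GL n K`. -/
def IsZariskiClosed (Z : Set (GL (Fin n) K)) : Prop :=
  ∃ I : Set (MvPolynomial (Fin n × Fin n) K),
    ∀ g : GL (Fin n) K, g ∈ Z ↔ ∀ p ∈ I, MvPolynomial.aeval (entries g.val) p = 0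

/-- The subgroup `H` of `GL n K` is the zero set of polynomials with coefficients in `F`; in
characteristic zero this says that `H` is a closed subgroup defined over `F`. -/
def IsDefinedOver (F : Type*) [Field F] [Algebra F K] (H : Subgroup (GL (Fin n) K)) : Prop :=
  ∃ I : Set (MvPolynomial (Fin n × Fin n) F),
    ∀ g : GL (Fin n) K, g ∈ H ↔ ∀ p ∈ I, MvPolynomial.aeval (entries g.val) p = 0

/-- Connectedness for the Zariski topology. -/
def IsZariskiConnected (H : Subgroup (GL (Fin n) K)) : Prop :=
  ∀ Y Z : Set (GL (Fin n) K), IsZariskiClosed Y → IsZariskiClosed Z →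
    Y ∪ Z = (H : Set (GL (Fin n) K)) → Disjoint Y Z → Y = ∅ ∨ Z = ∅

/-- A subgroup is unipotent if all its elements are unipotent matrices. -/
def IsUnipotentSubgroup (U : Subgroup (GL (Fin n) K)) : Prop :=
  ∀ u ∈ U, IsNilpotent (u.val - 1)

/-- A torus: a closed connected subgroup that can be diagonalized over `K`. -/
structure IsTorus (T : Subgroup (GL (Fin n) K)) : Prop where
  closed : IsZariskiClosed (T : Set (GL (Fin n) K))
  connected : IsZariskiConnected T
  diagonalizable : ∃ g : GL (Fin n) K, ∀ t ∈ T, (g * t * g⁻¹).val.IsDiag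

/-- A maximal torus of `G` (over the algebraically closed field `K`). -/
structure IsMaximalTorus (G T : Subgroup (GL (Fin n) K)) : Prop where
  le : T ≤ G
  isTorus : IsTorus T
  maximal : ∀ T' : Subgroup (GL (Fin n) K), IsTorus T' → T' ≤ G → T ≤ T' → T' = T

/-- Closed connected solvable subgroups of `G`. -/
structure IsClosedConnectedSolvable (G B : Subgroup (GL (Fin n) K)) : Prop where
  le : B ≤ G
  closed : IsZariskiClosed (B : Set (GL (Fin n) K))
  connected : IsZariskiConnected B
  solvable : Group.IsSolvable B

/-- A Borel subgroup of `G`: a maximal closed connected solvable subgroup. -/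
structure IsBorel (G B : Subgroup (GL (Fin n) K)) : Prop
    extends IsClosedConnectedSolvable G B where
  maximal : ∀ B' : Subgroup (GL (Fin n) K), IsClosedConnectedSolvable G B' → B ≤ B' → B' = B

/-- The Lie algebra of `H`: the matrices `X` such that `1 + ε X` is a point of `H` over the dual
numbers `K[ε]`. -/
def lieAlg (H : Subgroup (GL (Fin n) K)) : Set (Matrix (Fin n) (Fin n) K) :=
  {X | ∀ p : MvPolynomial (Fin n × Fin n) K,
      (∀ g ∈ H, MvPolynomial.aeval (entries g.val) p = 0) →
      MvPolynomial.aeval (entries ((1 : Matrix (Fin n) (Fin n) (DualNumber K)) +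
        X.map TrivSqZeroExt.inr)) p = 0}

/-- The regular functions on `H`: generated by the entries of `g` and of `g⁻¹`. -/
def regularFunctions (H : Subgroup (GL (Fin n) K)) : Subalgebra K (H → K) :=
  Algebra.adjoin K ({f | ∃ i j, f = fun g : H => (g : GL (Fin n) K).val i j} ∪
    {f | ∃ i j, f = fun g : H => ((g : GL (Fin n) K)⁻¹).val i j})

variable (K) in
/-- The regular functions on the multiplicative group: Laurent polynomials. -/
def laurentFunctions : Subalgebra K (Kˣ → K) :=
  Algebra.adjoin K {f | f = (fun t : Kˣ => (t : K)) ∨ f = fun t : Kˣ => ((t⁻¹ : Kˣ) : K)}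

variable (K) in
/-- The regular functions on `SL₂`: polynomials in the entries. -/
def sl2Functions : Subalgebra K (SL(2, K) → K) :=
  Algebra.adjoin K {f | ∃ i j, f = fun g : SL(2, K) => g.1 i j}

lemma regular_entry {H : Subgroup (GL (Fin n) K)} (i j : Fin n) :
    (fun g : H => (g : GL (Fin n) K).val i j) ∈ regularFunctions H :=
  Algebra.subset_adjoin (Or.inl ⟨i, j, rfl⟩)

lemma regular_entry_inv {H : Subgroup (GL (Fin n) K)} (i j : Fin n) :
    (fun g : H => ((g : GL (Fin n) K)⁻¹).val i j) ∈ regularFunctions H :=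
  Algebra.subset_adjoin (Or.inr ⟨i, j, rfl⟩)

lemma regular_const {H : Subgroup (GL (Fin n) K)} (a : K) :
    (fun _ : H => a) ∈ regularFunctions H :=
  (regularFunctions H).algebraMap_mem a

lemma regular_comp {H H' : Subgroup (GL (Fin n) K)} (φ : H → H')
    (h₁ : ∀ i j, (fun g : H => (φ g : GL (Fin n) K).val i j) ∈ regularFunctions H)
    (h₂ : ∀ i j, (fun g : H => ((φ g : GL (Fin n) K)⁻¹).val i j) ∈ regularFunctions H)
    {f : H' → K} (hf : f ∈ regularFunctions H') : f ∘ φ ∈ regularFunctions H := by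
  induction hf using Algebra.adjoin_induction with
  | mem f hf =>
    rcases hf with ⟨i, j, rfl⟩ | ⟨i, j, rfl⟩
    · exact h₁ i j
    · exact h₂ i j
  | algebraMap r => exact (regularFunctions H).algebraMap_mem r
  | add f g _ _ hf hg => exact (regularFunctions H).add_mem hf hg
  | mul f g _ _ hf hg => exact (regularFunctions H).mul_mem hf hg

lemma regular_gal {H : Subgroup (GL (Fin n) K)} (σ : Gal(K/F)) (φ : H → H)
    (h : ∀ g : H, ((φ g : H) : GL (Fin n) K) = gal σ⁻¹ (g : GL (Fin n) K))
    {f : H → K} (hf : f ∈ regularFunctions H) :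
    (fun g => σ (f (φ g))) ∈ regularFunctions H := by
  have key : ∀ x : K, σ (σ⁻¹ x) = x := fun x => σ.apply_symm_apply x
  induction hf using Algebra.adjoin_induction with
  | mem f hf =>
    rcases hf with ⟨i, j, rfl⟩ | ⟨i, j, rfl⟩
    · convert regular_entry (H := H) i j using 2 with g
      change σ ((φ g : GL (Fin n) K).val i j) = _
      rw [h g]
      exact key _
    · convert regular_entry_inv (H := H) i j using 2 with g
      change σ (((φ g : GL (Fin n) K)⁻¹).val i j) = _
      rw [h g, ← map_inv]
      exact key _
  | algebraMap r => exact (regularFunctions H).algebraMap_mem (σ r)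
  | add f g _ _ hf hg =>
    have := (regularFunctions H).add_mem hf hg
    convert this using 2 with x
    simp
  | mul f g _ _ hf hg =>
    have := (regularFunctions H).mul_mem hf hg
    convert this using 2 with x
    simp

lemma gal_mul_apply (σ τ : Gal(K/F)) (g : GL (Fin n) K) : gal (σ * τ) g = gal σ (gal τ g) := by
  ext i j; rfl

lemma gal_one_apply (g : GL (Fin n) K) : gal (1 : Gal(K/F)) g = g := by
  ext i j; rfl

lemma aeval_semilinear {R R' : Type*} [CommRing R] [CommRing R'] [Algebra K R] [Algebra K R']
    {ι : Type*} (σ : K →+* K) (Φ : R →+* R')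
    (h : ∀ a, Φ (algebraMap K R a) = algebraMap K R' (σ a)) (x : ι → R) (p : MvPolynomial ι K) :
    Φ (MvPolynomial.aeval x p) = MvPolynomial.aeval (fun i => Φ (x i)) (MvPolynomial.map σ p) := by
  induction p using MvPolynomial.induction_on with
  | C a => simp [h]
  | add p q hp hq => simp [hp, hq]
  | mul_X p i hp => simp [hp]

lemma gal_mem {H : Subgroup (GL (Fin n) K)} (hH : IsDefinedOver F H) (σ : Gal(K/F))
    {g : GL (Fin n) K} (hg : g ∈ H) : gal σ g ∈ H := by
  obtain ⟨I, hI⟩ := hH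
  rw [hI] at hg ⊢
  intro p hp
  have h := congrArg (σ : K →ₐ[F] K) (hg p hp)
  rw [map_zero, MvPolynomial.comp_aeval_apply] at h
  exact h

lemma IsTorus.comm {T : Subgroup (GL (Fin n) K)} (hT : IsTorus T) {s t : GL (Fin n) K}
    (hs : s ∈ T) (ht : t ∈ T) : s * t = t * s := by
  obtain ⟨g, hg⟩ := hT.diagonalizable
  have h : (g * s * g⁻¹) * (g * t * g⁻¹) = (g * t * g⁻¹) * (g * s * g⁻¹) := by
    apply Units.ext
    rw [Units.val_mul, Units.val_mul (g * t * g⁻¹)]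
    rw [← (hg s hs).diagonal_diag, ← (hg t ht).diagonal_diag, Matrix.diagonal_mul_diagonal,
      Matrix.diagonal_mul_diagonal]
    congr 1; ext i; exact mul_comm _ _
  have h' : g * (s * t) * g⁻¹ = g * (t * s) * g⁻¹ := by
    simpa only [mul_assoc, inv_mul_cancel_left] using h
  exact mul_left_cancel (mul_right_cancel h')

lemma lieAlg_smul {H : Subgroup (GL (Fin n) K)} (a : K) {X : Matrix (Fin n) (Fin n) K}
    (hX : X ∈ lieAlg H) : a • X ∈ lieAlg H := by
  intro p hp
  let φ : DualNumber K →ₐ[K] DualNumber K := TrivSqZeroExt.map (a • LinearMap.id)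
  have h := congrArg φ (hX p hp)
  rw [map_zero, MvPolynomial.comp_aeval_apply] at h
  rw [← h]
  congr 2
  ext ij <;> by_cases hij : ij.1 = ij.2 <;> simp [entries, φ, hij, mul_comm]

lemma lieAlg_gal {H : Subgroup (GL (Fin n) K)} (hH : IsDefinedOver F H) (σ : Gal(K/F))
    {X : Matrix (Fin n) (Fin n) K} (hX : X ∈ lieAlg H) : galMat σ X ∈ lieAlg H := by
  intro p hp
  let τ : K →+* K := (σ⁻¹ : Gal(K/F))
  let σ' : K →+* K := σ
  let φ : DualNumber K →+* DualNumber K :=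
    (DualNumber.lift (R := F) ⟨((TrivSqZeroExt.inlAlgHom F K K).comp (σ : K →ₐ[F] K),
      DualNumber.eps), by simp, fun _ => Commute.all _ _⟩).toRingHom
  have hστ : σ'.comp τ = RingHom.id K := by
    ext x; exact σ.apply_symm_apply x
  have hφ : ∀ x, φ x = TrivSqZeroExt.inl (σ x.fst) + TrivSqZeroExt.inr (σ x.snd) := by
    intro x
    change DualNumber.lift _ x = _
    rw [DualNumber.lift_apply_apply]
    ext <;> simp
  have h1 := hX (MvPolynomial.map τ p) (fun g hg => by
    have h2 := congrArg τ (hp _ (gal_mem hH σ hg))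
    rw [map_zero, aeval_semilinear τ τ (fun _ => rfl)] at h2
    rw [← h2]
    congr 2
    ext ij
    exact (σ.symm_apply_apply _).symm)
  have h3 := congrArg φ h1
  rw [map_zero, aeval_semilinear σ' φ (fun a => by
    rw [hφ]; ext <;> simp [σ', TrivSqZeroExt.algebraMap_eq_inl]), MvPolynomial.map_map, hστ,
    MvPolynomial.map_id] at h3
  rw [← h3]
  congr 2
  ext ij <;> by_cases hij : ij.1 = ij.2 <;> simp [entries, hφ, galMat, hij]

lemma lieAlg_conj {H : Subgroup (GL (Fin n) K)} {h : GL (Fin n) K} (hh : h ∈ H)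
    {X : Matrix (Fin n) (Fin n) K} (hX : X ∈ lieAlg H) : h.val * X * h⁻¹.val ∈ lieAlg H := by
  intro p hp
  let q : Fin n × Fin n → MvPolynomial (Fin n × Fin n) K := fun ij =>
    ∑ k, (∑ l, MvPolynomial.C (h.val ij.1 l) * MvPolynomial.X (l, k)) *
      MvPolynomial.C (h⁻¹.val k ij.2)
  have hq : ∀ {R : Type _} [CommRing R] [Algebra K R] (M : Matrix (Fin n) (Fin n) R),
      MvPolynomial.aeval (entries M) (MvPolynomial.bind₁ q p) = MvPolynomial.aeval
        (entries (h.val.map (algebraMap K R) * M * h⁻¹.val.map (algebraMap K R))) p := by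
    intro R _ _ M
    rw [MvPolynomial.aeval_bind₁]
    congr 2
    ext ij
    simp [q, entries, Matrix.mul_apply]
  have h1 := hX (MvPolynomial.bind₁ q p) (fun g hg => by
    rw [hq]
    exact hp (h * g * h⁻¹) (H.mul_mem (H.mul_mem hh hg) (H.inv_mem hh)))
  rw [hq] at h1
  rw [← h1]
  congr 2
  have e1 : h.val.map (algebraMap K (DualNumber K)) * h⁻¹.val.map (algebraMap K (DualNumber K))
      = 1 := by
    rw [← Matrix.map_mul, ← Units.val_mul, mul_inv_cancel]
    simp
  rw [mul_add, add_mul, mul_one, e1]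
  congr 1
  ext i j <;> simp [Matrix.mul_apply, TrivSqZeroExt.algebraMap_eq_inl,
    TrivSqZeroExt.fst_sum, TrivSqZeroExt.snd_sum, mul_comm]

end Basic

/-! ## Connected reductive groups, maximal tori, roots -/

/-- A connected reductive group over `F`: a connected linear algebraic group `G` over `F` whose only
closed connected normal unipotent subgroup (over `K`) is the trivial one. -/
structure ReductiveGroup (F K : Type*) [Field F] [Field K] [Algebra F K] (n : ℕ) where
  carrier : Subgroup (GL (Fin n) K)
  definedOver : IsDefinedOver F carrier
  connected : IsZariskiConnected carrier
  reductive : ∀ U : Subgroup (GL (Fin n) K), U ≤ carrier →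
    (∀ g ∈ carrier, ∀ u ∈ U, g * u * g⁻¹ ∈ U) → IsZariskiClosed (U : Set (GL (Fin n) K)) →
    IsZariskiConnected U → IsUnipotentSubgroup U → U = ⊥

variable {F K : Type*} [Field F] [Field K] [Algebra F K] {n : ℕ} {G : ReductiveGroup F K n}

/-- A maximal torus of `G` that is defined over `F`. -/
structure MaximalTorus (G : ReductiveGroup F K n) where
  carrier : Subgroup (GL (Fin n) K)
  isMaximal : IsMaximalTorus G.carrier carrier
  definedOver : IsDefinedOver F carrier

instance (T : MaximalTorus G) : CommGroup T.carrier :=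
  { (inferInstance : Group T.carrier) with
    mul_comm := fun s t => Subtype.ext (T.isMaximal.isTorus.comm s.2 t.2) }

/-- The algebraic characters of `T`. -/
def charGroup (T : MaximalTorus G) : Subgroup (T.carrier →* Kˣ) where
  carrier := {χ | (fun t => (χ t : K)) ∈ regularFunctions T.carrier}
  one_mem' := by simpa using regular_const (H := T.carrier) (1 : K)
  mul_mem' := fun {χ ψ} hχ hψ => by
    simpa [Pi.mul_def] using (regularFunctions T.carrier).mul_mem hχ hψ
  inv_mem' := fun {χ} hχ => by
    have := regular_comp (fun t : T.carrier => t⁻¹) regular_entry_inv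
      (fun i j => by simpa using regular_entry (H := T.carrier) i j) hχ
    simpa [Function.comp_def] using this

/-- The algebraic cocharacters of `T`. -/
def cocharGroup (T : MaximalTorus G) : Subgroup (Kˣ →* T.carrier) where
  carrier := {f | ∀ i j, (fun a => (f a : GL (Fin n) K).val i j) ∈ laurentFunctions K}
  one_mem' := fun i j => (laurentFunctions K).algebraMap_mem ((1 : Matrix (Fin n) (Fin n) K) i j)
  mul_mem' := fun {f g} hf hg i j => by
    have := (laurentFunctions K).sum_mem
      (fun k (_ : k ∈ Finset.univ) => (laurentFunctions K).mul_mem (hf i k) (hg k j))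
    convert this using 1
    ext a
    simp [Matrix.mul_apply]
  inv_mem' := fun {f} hf i j => by
    have key : ∀ g ∈ laurentFunctions K, (fun a : Kˣ => g a⁻¹) ∈ laurentFunctions K := by
      intro g hg
      induction hg using Algebra.adjoin_induction with
      | mem g hg =>
        rcases hg with rfl | rfl
        · exact Algebra.subset_adjoin (Or.inr rfl)
        · refine Algebra.subset_adjoin (Or.inl ?_)
          ext a; simp
      | algebraMap r => exact (laurentFunctions K).algebraMap_mem r
      | add f g _ _ hf hg => exact (laurentFunctions K).add_mem hf hg
      | mul f g _ _ hf hg => exact (laurentFunctions K).mul_mem hf hg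
    simpa using key _ (hf i j)

/-- The character lattice `X^*(T)`, written additively. -/
abbrev CharLat (T : MaximalTorus G) := Additive (charGroup T)

/-- The cocharacter lattice `X_*(T)`, written additively. -/
abbrev CocharLat (T : MaximalTorus G) := Additive (cocharGroup T)

/-- The value `χ(t)`. -/
def CharLat.val {T : MaximalTorus G} (χ : CharLat T) (t : T.carrier) : Kˣ := χ.toMul.1 t

/-- The value `f(a)`. -/
def CocharLat.val {T : MaximalTorus G} (f : CocharLat T) (a : Kˣ) : T.carrier := f.toMul.1 a

lemma CharLat.ext_val {T : MaximalTorus G} {χ ψ : CharLat T} (h : ∀ t, χ.val t = ψ.val t) :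
    χ = ψ :=
  Additive.toMul.injective (Subtype.ext (MonoidHom.ext h))

lemma CharLat.zero_val {T : MaximalTorus G} (t : T.carrier) : (0 : CharLat T).val t = 1 := rfl

/-- `X` is a vector of weight `χ` for the adjoint action of `T`. -/
def HasWeight (T : MaximalTorus G) (χ : CharLat T) (X : Matrix (Fin n) (Fin n) K) : Prop :=
  ∀ t : T.carrier, t.1.val * X * (t.1⁻¹).val = (χ.val t : K) • X

/-- `χ` is a root of `T` in `H`: a nonzero weight of `T` on the Lie algebra of `H`. -/
def IsRoot (T : MaximalTorus G) (H : Subgroup (GL (Fin n) K)) (χ : CharLat T) : Prop :=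
  χ ≠ 0 ∧ ∃ X ∈ lieAlg H, X ≠ 0 ∧ HasWeight T χ X

/-- The set of roots `R(T, G)`. -/
abbrev Root (G : ReductiveGroup F K n) (T : MaximalTorus G) := {χ : CharLat T // IsRoot T G.carrier χ}

/-! ### Actions on characters and roots -/

/-- `h A h⁻¹ = B`. -/
def Conjugates (h : GL (Fin n) K) (A B : Subgroup (GL (Fin n) K)) : Prop :=
  ∀ g, g ∈ A ↔ h * g * h⁻¹ ∈ B

lemma Conjugates.inv_mem {h : GL (Fin n) K} {A B : Subgroup (GL (Fin n) K)} (hc : Conjugates h A B)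
    {g : GL (Fin n) K} (hg : g ∈ B) : h⁻¹ * g * h ∈ A := by
  rw [hc]; simpa [mul_assoc] using hg

lemma Conjugates.symm {h : GL (Fin n) K} {A B : Subgroup (GL (Fin n) K)} (hc : Conjugates h A B) :
    Conjugates h⁻¹ B A := by
  intro g; rw [hc]; simp [mul_assoc]

lemma Conjugates.trans {h k : GL (Fin n) K} {A B C : Subgroup (GL (Fin n) K)}
    (hc : Conjugates h A B) (hk : Conjugates k B C) : Conjugates (k * h) A C := by
  intro g; rw [hc, hk]; simp [mul_assoc]

/-- If `h T h⁻¹ = S`, the isomorphism `S → T`, `s ↦ h⁻¹ s h`. -/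
def conjHom {T S : MaximalTorus G} (h : GL (Fin n) K) (hc : Conjugates h T.carrier S.carrier) :
    S.carrier →* T.carrier where
  toFun s := ⟨h⁻¹ * s * h, hc.inv_mem s.2⟩
  map_one' := by ext; simp
  map_mul' s t := by apply Subtype.ext; simp [mul_assoc]

/-- The character `Ad(h) χ : s ↦ χ(h⁻¹ s h)` of `S = h T h⁻¹`. -/
def CharLat.conj {T S : MaximalTorus G} (χ : CharLat T) (h : GL (Fin n) K)
    (hc : Conjugates h T.carrier S.carrier) : CharLat S :=
  Additive.ofMul ⟨χ.toMul.1.comp (conjHom h hc), by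
    have aux : ∀ (φ : S.carrier → Matrix (Fin n) (Fin n) K),
        (∀ i j, (fun s => φ s i j) ∈ regularFunctions S.carrier) →
        ∀ i j, (fun s => (h⁻¹.val * φ s * h.val) i j) ∈ regularFunctions S.carrier := by
      intro φ hφ i j
      have := (regularFunctions S.carrier).sum_mem (fun k (_ : k ∈ Finset.univ) =>
        (regularFunctions S.carrier).mul_mem ((regularFunctions S.carrier).sum_mem
          (fun l (_ : l ∈ Finset.univ) => (regularFunctions S.carrier).mul_mem
            (regular_const (h⁻¹.val i l)) (hφ l k))) (regular_const (h.val k j)))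
      convert this using 1
      ext s
      simp [Matrix.mul_apply]
    refine regular_comp (conjHom h hc) (fun i j => ?_) (fun i j => ?_) χ.toMul.2
    · exact aux (fun s => s.1.val) regular_entry i j
    · convert aux (fun s => (s.1⁻¹).val) regular_entry_inv i j using 2 with s
      simp [conjHom, mul_assoc]⟩

/-- The root `Ad(h) α` of `S = h T h⁻¹`, for `h ∈ G` and a root `α` of `T`. -/
def Root.conj {T S : MaximalTorus G} (α : Root G T) (h : GL (Fin n) K) (hG : h ∈ G.carrier)
    (hc : Conjugates h T.carrier S.carrier) : Root G S :=
  ⟨CharLat.conj α.1 h hc, by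
    obtain ⟨h0, X, hX, hX0, hw⟩ := α.2
    refine ⟨fun h1 => h0 ?_, h.val * X * h⁻¹.val, lieAlg_conj hG hX, fun h1 => hX0 ?_, fun s => ?_⟩
    · refine CharLat.ext_val fun t => ?_
      have h2 : (CharLat.conj α.1 h hc).val ⟨h * t * h⁻¹, (hc t).1 t.2⟩ = 1 := by
        rw [h1, CharLat.zero_val]
      rw [CharLat.zero_val, ← h2]
      refine congrArg α.1.val (Subtype.ext ?_)
      simp [conjHom, mul_assoc]
    · have h2 := congrArg (fun Y => h⁻¹.val * Y * h.val) h1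
      simpa [mul_assoc] using h2
    · have h2 := congrArg (fun Y => h.val * Y * h⁻¹.val) (hw (conjHom h hc s))
      simpa [conjHom, mul_assoc, CharLat.conj, CharLat.val] using h2⟩

/-- The action of `σ` on the points of `T`. -/
def galHom (T : MaximalTorus G) (σ : Gal(K/F)) : T.carrier →* T.carrier where
  toFun t := ⟨gal σ t.1, gal_mem T.definedOver σ t.2⟩
  map_one' := by ext; simp
  map_mul' s t := by apply Subtype.ext; simp

/-- The character `σχ : t ↦ σ(χ(σ⁻¹ t))`. -/
def CharLat.gal {T : MaximalTorus G} (χ : CharLat T) (σ : Gal(K/F)) : CharLat T :=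
  Additive.ofMul ⟨(Units.map (σ : K →* K)).comp (χ.toMul.1.comp (galHom T σ⁻¹)),
    regular_gal σ (galHom T σ⁻¹) (fun _ => rfl) χ.toMul.2⟩

/-- The root `σα`. -/
def Root.gal {T : MaximalTorus G} (α : Root G T) (σ : Gal(K/F)) : Root G T :=
  ⟨CharLat.gal α.1 σ, by
    obtain ⟨h0, X, hX, hX0, hw⟩ := α.2
    refine ⟨fun h1 => h0 ?_, galMat σ X, lieAlg_gal G.definedOver σ hX, fun h1 => hX0 ?_,
      fun t => ?_⟩
    · refine CharLat.ext_val fun t => ?_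
      have h2 : (CharLat.gal α.1 σ).val (galHom T σ t) = 1 := by
        rw [h1, CharLat.zero_val]
      have h3 : galHom T σ⁻¹ (galHom T σ t) = t := by
        apply Subtype.ext
        change SplInv.gal σ⁻¹ (SplInv.gal σ t.1) = t.1
        rw [← gal_mul_apply, inv_mul_cancel, gal_one_apply]
      have h4 : Units.map (σ : K →* K) (α.1.val t) = 1 := by
        rw [← h2]; exact congrArg (fun u => Units.map (σ : K →* K) (α.1.val u)) h3.symm
      rw [CharLat.zero_val]
      apply Units.ext
      exact σ.injective (by simpa using congrArg Units.val h4)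
    · ext i j
      have h2 : σ (X i j) = 0 := congrFun (congrFun h1 i) j
      simpa using h2
    · have h2 := congrArg (galMat σ) (hw (galHom T σ⁻¹ t))
      have h3 : SplInv.gal σ (galHom T σ⁻¹ t : GL (Fin n) K) = t.1 := by
        change SplInv.gal σ (SplInv.gal σ⁻¹ t.1) = t.1
        rw [← gal_mul_apply, mul_inv_cancel, gal_one_apply]
      have e1 : ∀ A B : Matrix (Fin n) (Fin n) K, galMat σ (A * B) = galMat σ A * galMat σ B :=
        fun A B => Matrix.map_mul (f := (σ : K →+* K))
      have e2 : ∀ (a : K) (A : Matrix (Fin n) (Fin n) K), galMat σ (a • A) = σ a • galMat σ A :=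
        fun a A => by ext; simp [galMat]
      have e3 : ∀ g : GL (Fin n) K, galMat σ g.val = (SplInv.gal σ g).val := fun g => rfl
      rw [e1, e1, e2, e3, e3, map_inv, h3] at h2
      exact h2⟩

/-! ## Splittings, families of scalars, `a`-data -/

/-- A root of `T` is positive with respect to `B` if it is a root of `T` in `B`. -/
def IsPositive {T : MaximalTorus G} (B : Subgroup (GL (Fin n) K)) (α : Root G T) : Prop :=
  IsRoot T B α.1

/-- A root is simple if it is positive and not a sum of two positive roots. -/
def IsSimple {T : MaximalTorus G} (B : Subgroup (GL (Fin n) K)) (α : Root G T) : Prop :=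
  IsPositive B α ∧ ¬ ∃ β γ : Root G T, IsPositive B β ∧ IsPositive B γ ∧ α.1 = β.1 + γ.1

/-- The set `Δ(T, B)` of simple roots. -/
abbrev SimpleRoot (T : MaximalTorus G) (B : Subgroup (GL (Fin n) K)) :=
  {α : Root G T // IsSimple B α}

/-- An `F`-splitting `(T, B, {X_α})` of `G`: a maximal torus `T` and a Borel subgroup `B`
containing it, both defined over `F`, and a nonzero root vector `X_α` for every simple root `α`,
such that the family `{X_α}` is stable under the Galois group. -/
structure FSplitting (G : ReductiveGroup F K n) where
  T : MaximalTorus G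
  B : Subgroup (GL (Fin n) K)
  isBorel : IsBorel G.carrier B
  definedOver : IsDefinedOver F B
  le : T.carrier ≤ B
  X : SimpleRoot T B → Matrix (Fin n) (Fin n) K
  X_mem : ∀ α, X α ∈ lieAlg G.carrier
  X_ne_zero : ∀ α, X α ≠ 0
  X_weight : ∀ α, HasWeight T α.1.1 (X α)
  X_gal : ∀ (σ : Gal(K/F)) (α β : SimpleRoot T B), β.1 = α.1.gal σ → X β = galMat σ (X α)

/-- A family `(c_α)` of elements of `Kˣ`, indexed by `R(T, G)`, that is invariant under the Weyl
group `N(T)/T` and the Galois group: `c_{wα} = c_α` and `c_{σα} = σ(c_α)`. -/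
structure InvariantFamily (T : MaximalTorus G) where
  c : Root G T → Kˣ
  weyl : ∀ (g : GL (Fin n) K) (hG : g ∈ G.carrier) (hT : Conjugates g T.carrier T.carrier)
    (α : Root G T), c (α.conj g hG hT) = c α
  gal : ∀ (σ : Gal(K/F)) (α : Root G T), (c (α.gal σ) : K) = σ (c α)

/-- The splitting `c · spl = (T, B, {c_α X_α})`. -/
def FSplitting.smul (spl : FSplitting G) (c : InvariantFamily spl.T) : FSplitting G :=
  { spl with
    X := fun α => (c.c α.1 : K) • spl.X α
    X_mem := fun α => lieAlg_smul _ (spl.X_mem α)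
    X_ne_zero := fun α => smul_ne_zero (c.c α.1).ne_zero (spl.X_ne_zero α)
    X_weight := fun α t => by
      rw [Matrix.mul_smul, Matrix.smul_mul, spl.X_weight α t, smul_comm]
    X_gal := fun σ α β h => by
      rw [h, c.gal, spl.X_gal σ α β h]
      ext i j
      simp [galMat] }

open Classical in
/-- The family on `R(S, G)` to which `c` is transported by any `h ∈ G` with `h T h⁻¹ = S`
(see `InvariantFamily.transport_conj`; such an `h` exists for all maximal tori `T`, `S`). -/
def InvariantFamily.transport {T : MaximalTorus G} (c : InvariantFamily T) (S : MaximalTorus G) :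
    Root G S → Kˣ :=
  if H : ∃ h, h ∈ G.carrier ∧ Conjugates h T.carrier S.carrier then
    fun β => c.c (β.conj H.choose⁻¹ (G.carrier.inv_mem H.choose_spec.1) H.choose_spec.2.symm)
  else 1

/-- The transported family is independent of the transporting element. -/
lemma InvariantFamily.transport_conj {T : MaximalTorus G} (c : InvariantFamily T)
    (S : MaximalTorus G) (h : GL (Fin n) K) (hG : h ∈ G.carrier)
    (hc : Conjugates h T.carrier S.carrier) (α : Root G T) :
    c.transport S (α.conj h hG hc) = c.c α := by
  have H : ∃ h, h ∈ G.carrier ∧ Conjugates h T.carrier S.carrier := ⟨h, hG, hc⟩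
  rw [InvariantFamily.transport, dif_pos H]
  have hk := H.choose_spec
  set k := H.choose
  rw [← c.weyl (k⁻¹ * h) (G.carrier.mul_mem (G.carrier.inv_mem hk.1) hG) (hc.trans hk.2.symm) α]
  congr 1
  apply Subtype.ext
  refine CharLat.ext_val fun t => ?_
  refine congrArg α.1.val (Subtype.ext ?_)
  simp [conjHom, mul_assoc]
  rfl

/-- `A = (a_β)` is a set of `a`-data for `R(S, G)`: `a_{σβ} = σ(a_β)` and `a_{-β} = -a_β`. -/
structure IsAData (S : MaximalTorus G) (A : Root G S → Kˣ) : Prop where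
  gal : ∀ (σ : Gal(K/F)) (β : Root G S), (A (β.gal σ) : K) = σ (A β)
  neg : ∀ β γ : Root G S, γ.1 = -β.1 → A γ = -A β

/-! ## Galois cohomology -/

/-- A continuous 1-cocycle of the Galois group with values in the discrete group `S(K)`. -/
structure Cocycle (S : MaximalTorus G) where
  toFun : Gal(K/F) → GL (Fin n) K
  mem : ∀ σ, toFun σ ∈ S.carrier
  cocycle : ∀ σ τ, toFun (σ * τ) = toFun σ * gal σ (toFun τ)
  continuous : IsLocallyConstant toFun

/-- Cohomologous cocycles: `z' σ = s⁻¹ z(σ) σ(s)` for some `s ∈ S(K)`. -/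
instance cocycleSetoid (S : MaximalTorus G) : Setoid (Cocycle S) where
  r z z' := ∃ s ∈ S.carrier, ∀ σ, z'.toFun σ = s⁻¹ * z.toFun σ * gal σ s
  iseqv :=
    { refl := fun z => ⟨1, S.carrier.one_mem, fun σ => by simp⟩
      symm := by
        rintro z z' ⟨s, hs, h⟩
        exact ⟨s⁻¹, S.carrier.inv_mem hs, fun σ => by rw [h]; simp [mul_assoc]⟩
      trans := by
        rintro z z' z'' ⟨s, hs, h⟩ ⟨t, ht, h'⟩
        exact ⟨s * t, S.carrier.mul_mem hs ht, fun σ => by rw [h', h]; simp [mul_assoc]⟩ }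

/-- The Galois cohomology `H¹(F, S)`. -/
def H1 (S : MaximalTorus G) := Quotient (cocycleSetoid S)

/-! ## The splitting invariant -/

/-- The based root datum of `(G, T, B)`: the (unique) root datum on `X^*(T)`, `X_*(T)` with the
canonical pairing `χ(f(a)) = a ^ ⟨χ, f⟩` and whose roots are the roots of `T` in `G` (its coroots `α^∨` are determined by the roots and the
pairing), with the base given by `B`. -/
structure BasedRootDatum (T : MaximalTorus G) (B : Subgroup (GL (Fin n) K)) where
  P : RootDatum (Root G T) (CharLat T) (CocharLat T)
  root_eq : ∀ α, P.root α = α.1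
  pairing : ∀ (χ : CharLat T) (f : CocharLat T) (a : Kˣ),
    χ.val (f.val a) = a ^ (P.toLinearMap χ f)
  base : P.Base
  mem_support_iff : ∀ α, α ∈ base.support ↔ IsSimple B α
  isPositive_iff : ∀ α, IsPositive B α ↔
    P.root α ∈ AddSubmonoid.closure (P.root '' (base.support : Set (Root G T)))

variable (K) in
/-- The matrix `(1 x; 0 1)`. -/
def sl2Upper (x : K) : SL(2, K) := ⟨!![1, x; 0, 1], by simp⟩

variable (K) in
/-- The matrix `(1 0; x 1)`. -/
def sl2Lower (x : K) : SL(2, K) := ⟨!![1, 0; x, 1], by simp⟩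

/-- The matrix `(a 0; 0 a⁻¹)`. -/
def sl2Diag (a : Kˣ) : SL(2, K) := ⟨!![(a : K), 0; 0, ((a⁻¹ : Kˣ) : K)], by simp⟩

variable (K) in
/-- The matrix `(0 1; -1 0)`. -/
def sl2Weyl : SL(2, K) := ⟨!![0, 1; -1, 0], by simp⟩

/-- The polynomial curve `u : K → GL n K` has derivative `X` at `0`. -/
def HasDerivAtZero (u : K → GL (Fin n) K) (X : Matrix (Fin n) (Fin n) K) : Prop :=
  ∃ q : Matrix (Fin n) (Fin n) (Polynomial K),
    ∀ i j, (∀ x, (u x).val i j = (q i j).eval x) ∧ (q i j).derivative.eval 0 = X i j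

/-- `η` is the homomorphism of algebraic groups `SL₂ → G` determined by the splitting and the simple
root `α`: it maps `(a 0; 0 a⁻¹)` to `α^∨(a)`, and its differential maps `(0 1; 0 0)` to `X_α` and
`(0 0; 1 0)` to a vector of weight `-α`. -/
structure IsPinnedHom (spl : FSplitting G) (D : BasedRootDatum spl.T spl.B)
    (α : SimpleRoot spl.T spl.B) (η : SL(2, K) →* GL (Fin n) K) : Prop where
  mem : ∀ g, η g ∈ G.carrier
  regular : ∀ i j, (fun g => (η g).val i j) ∈ sl2Functions K
  diag : ∀ a, η (sl2Diag a) = (CocharLat.val (D.P.coroot α.1) a : GL (Fin n) K)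
  deriv_upper : HasDerivAtZero (fun x => η (sl2Upper K x)) (spl.X α)
  deriv_lower : ∃ Y, HasWeight spl.T (-α.1.1) Y ∧ HasDerivAtZero (fun x => η (sl2Lower K x)) Y

/-- The product of the simple reflections in a word, acting on `X^*(T)`. -/
def wordProd {T : MaximalTorus G} {B : Subgroup (GL (Fin n) K)} (D : BasedRootDatum T B)
    (l : List (SimpleRoot T B)) : CharLat T ≃ₗ[ℤ] CharLat T :=
  (l.map fun α => D.P.reflection α.1).prod

/-- `l = (α₁, …, αₘ)` is a reduced expression `w = s_{α₁} ⋯ s_{αₘ}`. -/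
def IsReducedWord {T : MaximalTorus G} {B : Subgroup (GL (Fin n) K)} (D : BasedRootDatum T B)
    (w : CharLat T ≃ₗ[ℤ] CharLat T) (l : List (SimpleRoot T B)) : Prop :=
  wordProd D l = w ∧ ∀ l' : List (SimpleRoot T B), wordProd D l' = w → l.length ≤ l'.length

/-- `g` is `n_spl(w)`: for a reduced expression `w = s_{α₁} ⋯ s_{αₘ}` it is the product
`n_spl(s_{α₁}) ⋯ n_spl(s_{αₘ})`, where `n_spl(s_α)` is the image of `(0 1; -1 0)` under the
homomorphism `SL₂ → G` determined by the splitting and `α`. -/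
def IsTitsLift (spl : FSplitting G) (D : BasedRootDatum spl.T spl.B)
    (w : CharLat spl.T ≃ₗ[ℤ] CharLat spl.T) (g : GL (Fin n) K) : Prop :=
  ∃ (η : SimpleRoot spl.T spl.B → SL(2, K) →* GL (Fin n) K) (l : List (SimpleRoot spl.T spl.B)),
    (∀ α, IsPinnedHom spl D α (η α)) ∧ IsReducedWord D w l ∧
    g = (l.map fun α => η α (sl2Weyl K)).prod

/-- Conjugation by `g` preserves `T` and acts on `X^*(T)` by `w`, that is,
`(w χ)(g t g⁻¹) = χ(t)`. -/
def ActsBy {T : MaximalTorus G} (g : GL (Fin n) K) (w : CharLat T ≃ₗ[ℤ] CharLat T) : Prop :=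
  ∃ hc : Conjugates g T.carrier T.carrier, ∀ χ : CharLat T, CharLat.conj χ g hc = w χ

/-- The element `∏ α^∨(a_{Ad(h) α})` of `T`, the product being over the (finitely many) roots `α`
of `T` with `α > 0` and `w⁻¹ α < 0`. -/
def inversionProd {T : MaximalTorus G} {B : Subgroup (GL (Fin n) K)} (D : BasedRootDatum T B)
    (w : CharLat T ≃ₗ[ℤ] CharLat T) (a : Root G T → Kˣ) : T.carrier :=
  ∏ᶠ (α : Root G T) (_ : IsPositive B α ∧ ∃ β : Root G T, IsPositive B β ∧ w⁻¹ α.1 = -β.1),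
    CocharLat.val (D.P.coroot α) (a α)

/-- `x ∈ H¹(F, S)` is the Langlands–Shelstad splitting invariant `λ(S, A, spl)`.  Choose a Borel
subgroup `B_S` of `G` (over `K`) containing `S` and `h ∈ G(K)` with `Ad(h)(T, B) = (S, B_S)`; for
`σ` in the Galois group let `w_S(σ)` be the element of the Weyl group of `T` by which
`h⁻¹ σ(h)` acts, so that `Ad(h⁻¹)(σ s) = w_S(σ) σ(Ad(h⁻¹) s)` for `s ∈ S`.  Then `x` is the class
whose image under `Ad(h⁻¹)` is represented by
`σ ↦ ∏_{α > 0, w_S(σ)⁻¹ α < 0} α^∨(a_{Ad(h) α}) · n_spl(w_S(σ)) · σ(h⁻¹) h`. -/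
def IsSplittingInvariant (S : MaximalTorus G) (A : Root G S → Kˣ) (spl : FSplitting G)
    (x : H1 S) : Prop :=
  ∃ (D : BasedRootDatum spl.T spl.B) (BS : Subgroup (GL (Fin n) K)) (h : GL (Fin n) K)
    (hG : h ∈ G.carrier) (hS : Conjugates h spl.T.carrier S.carrier) (z : Cocycle S),
    IsBorel G.carrier BS ∧ S.carrier ≤ BS ∧ Conjugates h spl.B BS ∧
    x = Quotient.mk (cocycleSetoid S) z ∧
    ∀ σ : Gal(K/F), ∃ (w : CharLat spl.T ≃ₗ[ℤ] CharLat spl.T) (g : GL (Fin n) K),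
      ActsBy (h⁻¹ * gal σ h) w ∧ IsTitsLift spl D w g ∧
      h⁻¹ * z.toFun σ * h =
        (inversionProd D w fun α => A (Root.conj α h hG hS) : GL (Fin n) K) * g *
          (gal σ h⁻¹ * h)

end SplInv
end

/-! The two invariants agree because their cocycles agree, with the same based root datum, Borel
subgroup, `h` and cocycle `z`; no coboundary is needed. Replacing `X_α` by `c_α X_α` precomposes
`η_α` with conjugation by `diag(s, s⁻¹)`, where `s² = c_α` (`IsPinnedHom.twist`,
`IsPinnedHom.untwist`), and this multiplies `n(s_α)` on the left by `α^∨(c_α)`. In a product over a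
reduced word of `w`, these torus factors are pushed to the left. Passing a factor `β^∨(c_β)` across
`n(s_α)` turns it into the factor at `s_α β`, because `n(s_α)` acts on coroots by `s_α` and `c` is
Weyl invariant. The roots collected are exactly the inversions of `w`, each once, because `N(s_α w')
= {α} ⊔ s_α N(w')` when the word is reduced (`inversions_cons`, a consequence of the exchange
property). So `n_{c·spl}(w)` is `∏ α^∨(c_α) · n_spl(w)` over the positive roots with `w⁻¹α < 0`
(`prod_coroot_mul_weyl`). This is the index set of the `a`-data product, so the extra factor is
absorbed by replacing `a` with `c a`. The action of `n(s_α)` on `T` comes from the formula `t u(x)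
t⁻¹ = u(χ(t) x)` for the one-parameter subgroups in `η_α`; in characteristic zero it follows from
their derivatives at `0`. -/

noncomputable section

namespace SplInv

/-! ### Positive roots, the exchange property and inversion sets -/

section Combinatorics

variable {ι κ M N : Type*} [AddCommGroup M] [AddCommGroup N] {P : RootPairing ι ℤ M N}

/-- Bridges the height-based `IsPos` and the positivity axiom of `BasedRootDatum`. Membership in the
closure gives nonnegative height; conversely every root or its negative lies in the closure, and the
second case would make both signs positive. -/
lemma isPos_iff_mem_closure (b : P.Base) (i : ι) :
    b.IsPos i ↔ P.root i ∈ AddSubmonoid.closure (P.root '' (b.support : Set ι)) := by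
  classical
  have key : ∀ m ∈ AddSubmonoid.closure (P.root '' (b.support : Set ι)),
      ∃ f : ι → ℤ, 0 ≤ f ∧ m = ∑ j ∈ b.support, f j • P.root j := by
    intro m hm
    refine AddSubmonoid.closure_induction ?_ ⟨0, le_rfl, by simp⟩ ?_ hm
    · rintro - ⟨j, hj, rfl⟩
      refine ⟨Pi.single j 1, by simp, ?_⟩
      rw [Finset.sum_eq_single_of_mem j hj (by simp_all)]
      simp
    · rintro _ _ _ _ ⟨f, hf, rfl⟩ ⟨g, hg, rfl⟩
      exact ⟨f + g, add_nonneg hf hg, by simp [add_smul, Finset.sum_add_distrib]⟩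
  have key' : ∀ i, P.root i ∈ AddSubmonoid.closure (P.root '' (b.support : Set ι)) →
      b.IsPos i := by
    intro i hi
    obtain ⟨f, hf, h⟩ := key _ hi
    rw [b.isPos_iff', RootPairing.Base.height_eq_sum h]
    exact Finset.sum_nonneg fun j _ => hf j
  refine ⟨fun h => (b.root_mem_or_neg_mem i).resolve_right fun h' => ?_, key' i⟩
  let := P.indexNeg
  rw [← P.reflection_apply_self, ← P.root_reflectionPerm] at h'
  exact (RootPairing.Base.IsPos.neg_iff_not b i).1 (key' _ h') h

lemma root_ne_neg_of_isPos (b : P.Base) {i j : ι} (hi : b.IsPos i) (hj : b.IsPos j) :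
    P.root i ≠ -P.root j := by
  intro h
  let := P.indexNeg
  rw [P.root_eq_neg_iff] at h
  rw [h] at hi
  exact (RootPairing.Base.IsPos.neg_iff_not b j).1 hi hj

lemma isPos_reflectionPerm [Finite ι] (b : P.Base) {i j : ι} (hi : b.IsPos i)
    (hj : j ∈ b.support) (hij : i ≠ j) : b.IsPos (P.reflectionPerm j i) := by
  classical
  obtain ⟨f, hfs, hf, hfi⟩ := b.exists_root_eq_sum_int i
  have hf0 : 0 < f := by
    refine hf.resolve_right fun h => ?_
    have h1 := b.isPos_iff.1 hi
    rw [RootPairing.Base.height_eq_sum hfi] at h1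
    exact h1.not_ge (Finset.sum_nonpos fun k _ => h.le k)
  -- Otherwise root `i` is an integer multiple of the simple root `j`, hence `±` it; both signs are
  -- excluded. The reflection in `j` alters only the coefficient at `j`, so the positive coefficient
  -- at `k` survives and fixes the sign of all the others.
  obtain ⟨k, hk, hkj⟩ : ∃ k, 0 < f k ∧ k ≠ j := by
    by_contra! h
    have h0 : ∀ k, k ≠ j → f k = 0 := fun k hk =>
      le_antisymm (not_lt.1 fun h' => hk (h k h')) (hf0.le k)
    rw [Finset.sum_eq_single_of_mem j hj (fun k _ hk => by rw [h0 k hk, zero_smul])] at hfi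
    have := Module.IsReflexive.of_isPerfPair P.toLinearMap
    have := Module.IsReflexive.of_isPerfPair P.flip.toLinearMap
    have : IsAddTorsionFree M := IsAddTorsionFree.of_isTorsionFree ℤ M
    have : IsAddTorsionFree N := IsAddTorsionFree.of_isTorsionFree ℤ N
    rcases b.eq_one_or_neg_one_of_mem_support_of_smul_mem j hj (f j) ⟨i, hfi⟩ with h1 | h1
    · rw [h1, one_smul] at hfi
      exact hij (P.root.injective hfi)
    · have := hf0.le j
      simp [h1] at this
  have hs : P.root (P.reflectionPerm j i) =
      ∑ l ∈ b.support, (f - Pi.single j (P.pairing i j) : ι → ℤ) l • P.root l := by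
    simp only [Pi.sub_apply, sub_smul, Finset.sum_sub_distrib, ← hfi]
    rw [P.root_reflectionPerm, P.reflection_apply_root]
    congr 1
    rw [Finset.sum_eq_single_of_mem j hj (by simp_all)]
    simp
  rw [b.isPos_iff', RootPairing.Base.height_eq_sum hs]
  refine Finset.sum_nonneg fun l _ => ?_
  have hsupp : (f - Pi.single j (P.pairing i j) : ι → ℤ).support ⊆ b.support := by
    intro l hl
    by_cases hlj : l = j
    · rwa [hlj]
    · exact hfs (by simpa [hlj] using hl)
  rcases b.pos_or_neg_of_sum_smul_root_mem _ ⟨_, hs⟩ hsupp with h | h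
  · exact h.le l
  · have := h.le k
    simp [hkj] at this
    omega

/-- The positive roots that are made negative by `w⁻¹`. -/
def inversions (b : P.Base) (w : M ≃ₗ[ℤ] M) : Set ι :=
  {i | b.IsPos i ∧ ∃ j, b.IsPos j ∧ w⁻¹ (P.root i) = -P.root j}

lemma inversions_one (b : P.Base) : inversions b 1 = ∅ := by
  rw [Set.eq_empty_iff_forall_notMem]
  rintro i ⟨hi, j, hj, h⟩
  exact root_ne_neg_of_isPos b hi hj (by simpa using h)

lemma inv_reflection_mul_apply (w : M ≃ₗ[ℤ] M) (i j : ι) :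
    (P.reflection i * w)⁻¹ (P.root j) = w⁻¹ (P.root (P.reflectionPerm i j)) := by
  rw [mul_inv_rev, P.reflection_inv, P.root_reflectionPerm]
  rfl

/-- The exchange property. -/
lemma exists_shorter_word [Finite ι] (b : P.Base) {f : κ → ι} (hf : ∀ k, f k ∈ b.support)
    (l : List κ) (i : ι) (hi : i ∈ inversions b (l.map fun k => P.reflection (f k)).prod) :
    ∃ l' : List κ, l'.length < l.length ∧ (l'.map fun k => P.reflection (f k)).prod =
      P.reflection i * (l.map fun k => P.reflection (f k)).prod := by
  induction l generalizing i with
  | nil => simp [inversions_one] at hi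
  | cons k t ih =>
    rw [List.map_cons, List.prod_cons] at hi ⊢
    obtain ⟨hi, j, hj, h⟩ := hi
    -- If `i` is the first letter, that letter is deleted. Otherwise `s_k i` is still positive and
    -- is an inversion of the tail, and the shortened tail is transported back by `s_{s_k i} = s_k
    -- s_i s_k`.
    by_cases hik : i = f k
    · refine ⟨t, by simp, ?_⟩
      rw [hik, ← mul_assoc, ← sq, P.reflection_sq, one_mul]
    · rw [inv_reflection_mul_apply] at h
      obtain ⟨l', hl, hw⟩ := ih _ ⟨isPos_reflectionPerm b hi (hf k) hik, j, hj, h⟩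
      refine ⟨k :: l', by simpa using hl, ?_⟩
      rw [List.map_cons, List.prod_cons, hw, P.reflection_reflectionPerm]
      simp only [← mul_assoc]
      rw [← sq, P.reflection_sq, one_mul]

lemma exists_root_eq_word_inv (f : κ → ι) (l : List κ) (i : ι) :
    ∃ j, (l.map fun k => P.reflection (f k)).prod⁻¹ (P.root i) = P.root j := by
  induction l generalizing i with
  | nil => exact ⟨i, by simp⟩
  | cons k t ih =>
    rw [List.map_cons, List.prod_cons, inv_reflection_mul_apply]
    exact ih _

/-- `l` is a shortest word for the product of its reflections. -/
def IsShortest (P : RootPairing ι ℤ M N) (f : κ → ι) (l : List κ) : Prop :=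
  ∀ l' : List κ, (l'.map fun k => P.reflection (f k)).prod =
    (l.map fun k => P.reflection (f k)).prod → l.length ≤ l'.length

lemma IsShortest.tail {f : κ → ι} {k : κ} {t : List κ} (h : IsShortest P f (k :: t)) :
    IsShortest P f t := by
  intro l' hl'
  have := h (k :: l') (by simp [hl'])
  simpa using this

/-- A simple reflection permutes the positive roots other than its own, so only the first letter can
create or cancel an inversion. It cannot be an inversion of the tail, since the exchange property
would then give a shorter word. -/
lemma inversions_cons [Finite ι] (b : P.Base) {f : κ → ι} (hf : ∀ k, f k ∈ b.support)
    {k : κ} {t : List κ} (h : IsShortest P f (k :: t)) :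
    inversions b ((k :: t).map fun k => P.reflection (f k)).prod =
      insert (f k)
        (P.reflectionPerm (f k) '' inversions b (t.map fun k => P.reflection (f k)).prod) := by
  have hk : f k ∉ inversions b (t.map fun k => P.reflection (f k)).prod := by
    intro hk
    obtain ⟨l', hl, hw⟩ := exists_shorter_word b hf t _ hk
    have := h l' (by rw [hw, List.map_cons, List.prod_cons])
    simp at this
    omega
  have hkp := b.isPos_of_mem_support (hf k)
  rw [List.map_cons, List.prod_cons]
  ext i
  constructor
  · rintro ⟨hi, j, hj, hw⟩
    rw [Set.mem_insert_iff, or_iff_not_imp_left]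
    intro hik
    rw [inv_reflection_mul_apply] at hw
    exact ⟨_, ⟨isPos_reflectionPerm b hi (hf k) hik, j, hj, hw⟩, P.reflectionPerm_self _ _⟩
  · rintro (rfl | ⟨i, ⟨hi, j, hj, hw⟩, rfl⟩)
    · obtain ⟨j, hj⟩ := exists_root_eq_word_inv (P := P) f t (f k)
      refine ⟨hkp, j, ?_, ?_⟩
      · by_contra hjn
        let := P.indexNeg
        have := (RootPairing.Base.IsPos.or_neg b j).resolve_left hjn
        refine hk ⟨hkp, _, this, ?_⟩
        change _ = -P.root (P.reflectionPerm j j)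
        rw [hj, P.root_reflectionPerm, P.reflection_apply_self, neg_neg]
      · rw [inv_reflection_mul_apply, P.root_reflectionPerm, P.reflection_apply_self, map_neg, hj]
    · refine ⟨isPos_reflectionPerm b hi (hf k) ?_, j, hj, ?_⟩
      · rintro rfl
        exact hk ⟨hi, j, hj, hw⟩
      · rw [inv_reflection_mul_apply, P.reflectionPerm_self, hw]

/-- The preimage of `i` under its own reflection is `-i`, which is not positive. This makes the
union in `inversions_cons` disjoint, so products split along it. -/
lemma notMem_image_inversions (b : P.Base) {i : ι} (hi : i ∈ b.support) (w : M ≃ₗ[ℤ] M) :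
    i ∉ P.reflectionPerm i '' inversions b w := by
  rintro ⟨j, hj, h⟩
  have h1 := congrArg P.root h
  rw [P.root_reflectionPerm, ← P.reflection_same i (P.root i), P.reflection_apply_self] at h1
  have h2 := (P.reflection i).injective h1
  exact root_ne_neg_of_isPos b hj.1 (b.isPos_of_mem_support hi) h2

end Combinatorics

/-! ### Finiteness of the roots, one-parameter subgroups, and the action of `n(s_α)` on the torus -/

section Pinned

variable {F K : Type*} [Field F] [Field K] [Algebra F K] {n : ℕ} {G : ReductiveGroup F K n}

/-- A maximal torus has finitely many roots. -/
lemma finite_root (T : MaximalTorus G) : Finite (Root G T) := by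
  let f : T.carrier → Module.End K (Matrix (Fin n) (Fin n) K) := fun t =>
    LinearMap.mulLeft K t.1.val * LinearMap.mulRight K (t.1⁻¹).val
  have hf : ∀ t X, f t X = t.1.val * X * (t.1⁻¹).val := fun t X => by
    simp [f, mul_assoc]
  have hcomm : ∀ s t, Commute (f s) (f t) := by
    intro s t
    have h1 : s.1 * t.1 = t.1 * s.1 := T.isMaximal.isTorus.comm s.2 t.2
    have h2 : s.1.val * t.1.val = t.1.val * s.1.val := congrArg Units.val h1
    have h3 : (t.1⁻¹).val * (s.1⁻¹).val = (s.1⁻¹).val * (t.1⁻¹).val := by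
      rw [← Units.val_mul, ← Units.val_mul, ← mul_inv_rev, ← mul_inv_rev, h1]
    refine LinearMap.ext fun X => ?_
    change f s (f t X) = f t (f s X)
    rw [hf, hf, hf, hf]
    calc s.1.val * (t.1.val * X * (t.1⁻¹).val) * (s.1⁻¹).val
        = (s.1.val * t.1.val) * X * ((t.1⁻¹).val * (s.1⁻¹).val) := by simp only [mul_assoc]
      _ = t.1.val * (s.1.val * X * (s.1⁻¹).val) * (t.1⁻¹).val := by
        rw [h2, h3]; simp only [mul_assoc]
  -- Joint generalized eigenspaces of commuting operators are independent, so only finitely many are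
  -- nonzero in a finite-dimensional space. Roots inject into the nonzero ones.
  have hind := Module.End.independent_iInf_maxGenEigenspace_of_forall_mapsTo f
    fun s t φ => Module.End.mapsTo_maxGenEigenspace_of_comm (hcomm t s) φ
  have hfin := WellFoundedGT.finite_ne_bot_of_iSupIndep hind
  let e : Root G T → T.carrier → K := fun α t => α.1.val t
  have he : Function.Injective e := fun α β h =>
    Subtype.ext (CharLat.ext_val fun t => Units.ext (congrFun h t))
  refine @Finite.of_injective _ _ hfin.to_subtype (fun α => ⟨e α, ?_⟩)
    fun α β h => he (congrArg Subtype.val h)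
  obtain ⟨-, X, -, hX, hw⟩ := α.2
  refine (Submodule.ne_bot_iff _).2 ⟨X, ?_, hX⟩
  rw [Submodule.mem_iInf]
  intro t
  refine Module.End.mem_maxGenEigenspace _ _ _ |>.2 ⟨1, ?_⟩
  rw [pow_one, LinearMap.sub_apply, hf, hw t]
  exact sub_self _

/-- A polynomial one-parameter subgroup is determined by its derivative. -/
lemma eq_of_hasDerivAtZero [CharZero K] {u v : K → GL (Fin n) K} {X : Matrix (Fin n) (Fin n) K}
    (hu : ∀ x y, u (x + y) = u x * u y) (hv : ∀ x y, v (x + y) = v x * v y)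
    (hu' : HasDerivAtZero u X) (hv' : HasDerivAtZero v X) : u = v := by
  -- The equation `w' = w X` is read as the coefficient recursion `(m + 1) q_{m+1} = q_m X` with
  -- `q_0 = 1`; characteristic zero makes its solution unique.
  have key : ∀ (w : K → GL (Fin n) K) (q : Matrix (Fin n) (Fin n) (Polynomial K)),
      (∀ x y, w (x + y) = w x * w y) →
      (∀ i j, (∀ x, (w x).val i j = (q i j).eval x) ∧ (q i j).derivative.eval 0 = X i j) →
      (∀ i j, (q i j).coeff 0 = (1 : Matrix (Fin n) (Fin n) K) i j) ∧
      ∀ i j m, (q i j).coeff (m + 1) * (m + 1) = ∑ k, (q i k).coeff m * X k j := by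
    intro w q hw hq
    have h0 : w 0 = 1 := by simpa using hw 0 0
    have h1 : ∀ i j, (q i j).derivative = ∑ k, q i k * Polynomial.C (X k j) := by
      intro i j
      refine Polynomial.funext fun x => ?_
      -- The identity `w(y + x) = w(x) w(y)` as polynomials in `y`; its derivative at `y = 0` is the
      -- differential equation at `x`.
      have h2 : (q i j).comp (Polynomial.X + Polynomial.C x) =
          ∑ k, Polynomial.C ((q i k).eval x) * q k j := by
        refine Polynomial.funext fun y => ?_
        have := congrArg (fun g : GL (Fin n) K => g.val i j) (hw x y)
        simp only [Units.val_mul, Matrix.mul_apply, (hq _ _).1] at this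
        simpa [Polynomial.eval_finsetSum, add_comm y x] using this
      have h3 := congrArg (fun p => Polynomial.eval 0 (Polynomial.derivative p)) h2
      simpa [Polynomial.derivative_comp, Polynomial.eval_finsetSum, (hq _ _).2] using h3
    refine ⟨fun i j => ?_, fun i j m => ?_⟩
    · rw [Polynomial.coeff_zero_eq_eval_zero, ← (hq i j).1, h0]
      rfl
    · rw [← Polynomial.coeff_derivative, h1]
      simp
  obtain ⟨q, hq⟩ := hu'
  obtain ⟨r, hr⟩ := hv'
  obtain ⟨q0, q1⟩ := key u q hu hq
  obtain ⟨r0, r1⟩ := key v r hv hr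
  have h : ∀ m i j, (q i j).coeff m = (r i j).coeff m := by
    intro m
    induction m with
    | zero => intro i j; rw [q0, r0]
    | succ m ih =>
      intro i j
      have h1 : ((m : K) + 1) ≠ 0 := by exact_mod_cast m.succ_ne_zero
      refine mul_right_cancel₀ h1 ?_
      rw [q1, r1]
      simp only [ih]
  funext x
  ext i j
  rw [(hq i j).1, (hr i j).1, Polynomial.ext fun m => h m i j]

lemma HasDerivAtZero.conj {u : K → GL (Fin n) K} {X : Matrix (Fin n) (Fin n) K}
    (h : HasDerivAtZero u X) (g : GL (Fin n) K) :
    HasDerivAtZero (fun x => g * u x * g⁻¹) (g.val * X * (g⁻¹).val) := by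
  obtain ⟨q, hq⟩ := h
  refine ⟨fun i j => ∑ k, (∑ l, Polynomial.C (g.val i l) * q l k) * Polynomial.C ((g⁻¹).val k j),
    fun i j => ⟨fun x => ?_, ?_⟩⟩
  · simp [Matrix.mul_apply, Polynomial.eval_finsetSum, (hq _ _).1]
  · simp [Matrix.mul_apply, Polynomial.eval_finsetSum, (hq _ _).2]

lemma HasDerivAtZero.comp_mul {u : K → GL (Fin n) K} {X : Matrix (Fin n) (Fin n) K}
    (h : HasDerivAtZero u X) (a : K) : HasDerivAtZero (fun x => u (a * x)) (a • X) := by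
  obtain ⟨q, hq⟩ := h
  refine ⟨fun i j => (q i j).comp (Polynomial.C a * Polynomial.X), fun i j => ⟨fun x => ?_, ?_⟩⟩
  · simp [(hq _ _).1]
  · simp [Polynomial.derivative_comp, (hq _ _).2]

/-- Both sides are polynomial one-parameter subgroups in `x` with derivative `χ(t) X` at `0`. -/
lemma HasWeight.conj_eq [CharZero K] {T : MaximalTorus G} {χ : CharLat T}
    {X : Matrix (Fin n) (Fin n) K} (hw : HasWeight T χ X) {u : K → GL (Fin n) K}
    (hu : ∀ x y, u (x + y) = u x * u y) (hd : HasDerivAtZero u X) (t : T.carrier) (x : K) :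
    t.1 * u x * t.1⁻¹ = u (χ.val t * x) := by
  have h := hd.conj t.1
  rw [hw t] at h
  refine congrFun (eq_of_hasDerivAtZero (fun x y => ?_) (fun x y => ?_) h
    (hd.comp_mul (χ.val t : K))) x
  · simp [hu, mul_assoc]
  · rw [mul_add, hu]

lemma sl2Upper_add (x y : K) : sl2Upper K (x + y) = sl2Upper K x * sl2Upper K y := by
  apply Subtype.ext
  simp only [Matrix.SpecialLinearGroup.coe_mul]
  ext i j
  fin_cases i <;> fin_cases j <;> simp [sl2Upper, add_comm]

lemma sl2Lower_add (x y : K) : sl2Lower K (x + y) = sl2Lower K x * sl2Lower K y := by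
  apply Subtype.ext
  simp only [Matrix.SpecialLinearGroup.coe_mul]
  ext i j
  fin_cases i <;> fin_cases j <;> simp [sl2Lower]

/-- With `a = α(t)`, the right side is what conjugation by `t` makes of the unipotent factorization
`sl2Weyl_eq`. -/
lemma sl2Diag_mul_sl2Weyl (a : Kˣ) : sl2Diag a * sl2Weyl K =
    sl2Upper K a * sl2Lower K (-(a⁻¹ : Kˣ)) * sl2Upper K a := by
  apply Subtype.ext
  simp only [Matrix.SpecialLinearGroup.coe_mul]
  ext i j
  fin_cases i <;> fin_cases j <;> simp [sl2Upper, sl2Lower, sl2Diag, sl2Weyl]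

lemma sl2Weyl_eq : sl2Weyl K = sl2Upper K 1 * sl2Lower K (-1) * sl2Upper K 1 := by
  apply Subtype.ext
  simp only [Matrix.SpecialLinearGroup.coe_mul]
  ext i j
  fin_cases i <;> fin_cases j <;> simp [sl2Upper, sl2Lower, sl2Weyl]

lemma sl2Weyl_mul_self : sl2Weyl K * sl2Weyl K = sl2Diag (-1) := by
  apply Subtype.ext
  simp only [Matrix.SpecialLinearGroup.coe_mul]
  ext i j
  fin_cases i <;> fin_cases j <;> simp [sl2Diag, sl2Weyl]

variable {spl : FSplitting G} {D : BasedRootDatum spl.T spl.B} {α : SimpleRoot spl.T spl.B}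
  {η : SL(2, K) →* GL (Fin n) K}

/-- Conjugation by `t` rescales the three unipotent factors of `n(s_α)` by `α(t)^{±1}`, and these
recombine by `sl2Diag_mul_sl2Weyl`. -/
lemma IsPinnedHom.torus_mul [CharZero K] (hη : IsPinnedHom spl D α η) (t : spl.T.carrier) :
    t.1 * η (sl2Weyl K) * t.1⁻¹ =
      (CocharLat.val (D.P.coroot α.1) (α.1.1.val t) : GL (Fin n) K) * η (sl2Weyl K) := by
  obtain ⟨Y, hY, hd⟩ := hη.deriv_lower
  have h1 : ∀ x, t.1 * η (sl2Upper K x) * t.1⁻¹ = η (sl2Upper K (α.1.1.val t * x)) :=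
    (spl.X_weight α).conj_eq (u := fun x => η (sl2Upper K x))
      (fun x y => by rw [sl2Upper_add, map_mul]) hη.deriv_upper t
  have h2 : ∀ x, t.1 * η (sl2Lower K x) * t.1⁻¹ =
      η (sl2Lower K (((-α.1.1 : CharLat spl.T).val t : Kˣ) * x)) :=
    hY.conj_eq (u := fun x => η (sl2Lower K x))
      (fun x y => by rw [sl2Lower_add, map_mul]) hd t
  have h3 : (-α.1.1 : CharLat spl.T).val t = (α.1.1.val t)⁻¹ := rfl
  rw [← hη.diag, ← map_mul, sl2Diag_mul_sl2Weyl, sl2Weyl_eq, map_mul, map_mul, map_mul, map_mul]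
  have h4 := h1 1
  have h5 := h2 (-1)
  rw [mul_one] at h4
  rw [h3, mul_neg_one] at h5
  rw [← h4, ← h5]
  simp [mul_assoc]

lemma IsPinnedHom.weyl_sq (hη : IsPinnedHom spl D α η) :
    η (sl2Weyl K) * η (sl2Weyl K) = (CocharLat.val (D.P.coroot α.1) (-1) : GL (Fin n) K) := by
  rw [← map_mul, sl2Weyl_mul_self, hη.diag]

lemma IsPinnedHom.weyl_conj [CharZero K] (hη : IsPinnedHom spl D α η) (t : spl.T.carrier) :
    η (sl2Weyl K) * t.1 * (η (sl2Weyl K))⁻¹ =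
      (t * (CocharLat.val (D.P.coroot α.1) (α.1.1.val t))⁻¹ : spl.T.carrier) := by
  have h := hη.torus_mul t
  rw [mul_inv_eq_iff_eq_mul] at h
  rw [mul_comm t, Subgroup.coe_mul, Subgroup.coe_inv, eq_inv_mul_iff_mul_eq, ← mul_assoc,
    ← mul_assoc, ← h, mul_inv_cancel_right]

/-- Since `n(s_α)² = α^∨(-1)` lies in the commutative group `T`, conjugation by `n(s_α)` and by its
inverse agree on `T`. -/
lemma IsPinnedHom.weyl_inv_conj [CharZero K] (hη : IsPinnedHom spl D α η) (t : spl.T.carrier) :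
    (η (sl2Weyl K))⁻¹ * t.1 * η (sl2Weyl K) =
      (t * (CocharLat.val (D.P.coroot α.1) (α.1.1.val t))⁻¹ : spl.T.carrier) := by
  have h1 : (t.1 : GL (Fin n) K) * (η (sl2Weyl K) * η (sl2Weyl K)) =
      η (sl2Weyl K) * η (sl2Weyl K) * t.1 := by
    rw [hη.weyl_sq]
    exact spl.T.isMaximal.isTorus.comm t.2 (Subtype.prop _)
  rw [← hη.weyl_conj, mul_assoc, inv_mul_eq_iff_eq_mul, eq_comm, ← mul_assoc,
    mul_inv_eq_iff_eq_mul, mul_assoc t.1, h1]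
  simp [mul_assoc]

lemma IsPinnedHom.weyl_conjugates [CharZero K] (hη : IsPinnedHom spl D α η) :
    Conjugates (η (sl2Weyl K)) spl.T.carrier spl.T.carrier := by
  intro g
  constructor
  · intro hg
    rw [hη.weyl_conj ⟨g, hg⟩]
    exact Subtype.prop _
  · intro hg
    have := hη.weyl_inv_conj ⟨_, hg⟩
    simp only [mul_assoc, inv_mul_cancel_left, inv_mul_cancel, mul_one] at this
    rw [this]
    exact Subtype.prop _

/-- Identifies the action of a normalizer element with the abstract reflection of the root datum:
evaluating `β` on `t α^∨(α(t))⁻¹` gives `β - ⟨β, α^∨⟩ α`. -/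
lemma IsPinnedHom.conj_root [CharZero K] (hη : IsPinnedHom spl D α η) (β : Root G spl.T) :
    β.conj (η (sl2Weyl K)) (hη.mem _) hη.weyl_conjugates = D.P.reflectionPerm α.1 β := by
  apply Subtype.ext
  rw [← D.root_eq (D.P.reflectionPerm α.1 β), D.P.root_reflectionPerm, D.P.reflection_apply,
    D.root_eq, D.root_eq]
  refine CharLat.ext_val fun t => ?_
  have h1 : conjHom _ hη.weyl_conjugates t =
      t * (CocharLat.val (D.P.coroot α.1) (α.1.1.val t))⁻¹ := Subtype.ext (hη.weyl_inv_conj t)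
  change β.1.val (conjHom _ hη.weyl_conjugates t) = _
  rw [h1]
  have h2 : β.1.val (t * (CocharLat.val (D.P.coroot α.1) (α.1.1.val t))⁻¹) =
      β.1.val t * (β.1.val (CocharLat.val (D.P.coroot α.1) (α.1.1.val t)))⁻¹ :=
    (map_mul β.1.toMul.1 _ _).trans (congrArg _ (map_inv β.1.toMul.1 _))
  rw [h2, D.pairing, ← div_eq_mul_inv]
  rfl

lemma CocharLat.sub_val {T : MaximalTorus G} (f g : CocharLat T) (a : Kˣ) :
    (f - g).val a = f.val a / g.val a := by
  rw [div_eq_mul_inv]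
  rfl

lemma CocharLat.zsmul_val {T : MaximalTorus G} (m : ℤ) (f : CocharLat T) (a : Kˣ) :
    (m • f).val a = f.val (a ^ m) :=
  (map_zpow f.toMul.1 a m).symm

lemma IsPinnedHom.weyl_conj_coroot [CharZero K] (hη : IsPinnedHom spl D α η) (β : Root G spl.T)
    (a : Kˣ) :
    η (sl2Weyl K) * (CocharLat.val (D.P.coroot β) a : GL (Fin n) K) * (η (sl2Weyl K))⁻¹ =
      (CocharLat.val (D.P.coroot (D.P.reflectionPerm α.1 β)) a : GL (Fin n) K) := by
  rw [hη.weyl_conj, D.pairing, D.P.coroot_reflectionPerm, D.P.coreflection_apply,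
    CocharLat.sub_val, CocharLat.zsmul_val, div_eq_mul_inv, ← D.root_eq]

end Pinned

/-! ### Rescaling a pinned homomorphism by the diagonal torus of `SL₂` -/

section Twist

variable {F K : Type*} [Field F] [Field K] [Algebra F K] {n : ℕ} {G : ReductiveGroup F K n}

/-- The homomorphism `η` precomposed with conjugation by `(s 0; 0 s⁻¹)`. -/
def twistHom (s : Kˣ) (η : SL(2, K) →* GL (Fin n) K) : SL(2, K) →* GL (Fin n) K :=
  η.comp (MulAut.conj (sl2Diag s)).toMonoidHom

lemma twistHom_apply (s : Kˣ) (η : SL(2, K) →* GL (Fin n) K) (g : SL(2, K)) :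
    twistHom s η g = η (sl2Diag s * g * (sl2Diag s)⁻¹) := rfl

lemma sl2Diag_conj_upper (s : Kˣ) (x : K) :
    sl2Diag s * sl2Upper K x * (sl2Diag s)⁻¹ = sl2Upper K ((s ^ 2 : Kˣ) * x) := by
  rw [mul_inv_eq_iff_eq_mul]
  apply Subtype.ext
  simp only [Matrix.SpecialLinearGroup.coe_mul]
  ext i j
  fin_cases i <;> fin_cases j <;> simp [sl2Diag, sl2Upper]
  field_simp

lemma sl2Diag_conj_lower (s : Kˣ) (x : K) :
    sl2Diag s * sl2Lower K x * (sl2Diag s)⁻¹ = sl2Lower K (((s ^ 2)⁻¹ : Kˣ) * x) := by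
  rw [mul_inv_eq_iff_eq_mul]
  apply Subtype.ext
  simp only [Matrix.SpecialLinearGroup.coe_mul]
  ext i j
  fin_cases i <;> fin_cases j <;> simp [sl2Diag, sl2Lower]
  field_simp

lemma sl2Diag_conj_diag (s a : Kˣ) :
    sl2Diag s * sl2Diag a * (sl2Diag s)⁻¹ = sl2Diag a := by
  rw [mul_inv_eq_iff_eq_mul]
  apply Subtype.ext
  simp only [Matrix.SpecialLinearGroup.coe_mul]
  ext i j
  fin_cases i <;> fin_cases j <;> simp [sl2Diag, mul_comm]

lemma sl2Diag_conj_weyl (s : Kˣ) :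
    sl2Diag s * sl2Weyl K * (sl2Diag s)⁻¹ = sl2Diag (s ^ 2) * sl2Weyl K := by
  rw [mul_inv_eq_iff_eq_mul]
  apply Subtype.ext
  simp only [Matrix.SpecialLinearGroup.coe_mul]
  ext i j
  fin_cases i <;> fin_cases j <;> simp [sl2Diag, sl2Weyl]
  all_goals field_simp

lemma sl2Functions_conj (d : SL(2, K)) {f : SL(2, K) → K} (hf : f ∈ sl2Functions K) :
    (fun g => f (d * g * d⁻¹)) ∈ sl2Functions K := by
  induction hf using Algebra.adjoin_induction with
  | mem f hf =>
    obtain ⟨i, j, rfl⟩ := hf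
    have := (sl2Functions K).sum_mem (fun k (_ : k ∈ Finset.univ) =>
      (sl2Functions K).mul_mem ((sl2Functions K).sum_mem
        (fun l (_ : l ∈ Finset.univ) => (sl2Functions K).mul_mem
          ((sl2Functions K).algebraMap_mem (d.1 i l))
          (Algebra.subset_adjoin ⟨l, k, rfl⟩ : (fun g : SL(2, K) => g.1 l k) ∈ sl2Functions K)))
        ((sl2Functions K).algebraMap_mem (d⁻¹.1 k j)))
    convert this using 1
    funext g
    change (d.1 * g.1 * d⁻¹.1) i j = _
    simp only [Matrix.mul_apply, Finset.sum_apply, Pi.mul_apply, Pi.algebraMap_apply,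
      Algebra.algebraMap_self, RingHom.id_apply]
  | algebraMap r => exact (sl2Functions K).algebraMap_mem r
  | add f g _ _ hf hg => exact (sl2Functions K).add_mem hf hg
  | mul f g _ _ hf hg => exact (sl2Functions K).mul_mem hf hg

lemma HasWeight.smul {T : MaximalTorus G} {χ : CharLat T} {X : Matrix (Fin n) (Fin n) K}
    (h : HasWeight T χ X) (a : K) : HasWeight T χ (a • X) := fun t => by
  rw [Matrix.mul_smul, Matrix.smul_mul, h t, smul_comm]

variable {spl : FSplitting G} {D : BasedRootDatum spl.T spl.B} {α : SimpleRoot spl.T spl.B}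
  {η : SL(2, K) →* GL (Fin n) K}

lemma twistHom_upper_deriv {X : Matrix (Fin n) (Fin n) K}
    (h : HasDerivAtZero (fun x => η (sl2Upper K x)) X) (s : Kˣ) :
    HasDerivAtZero (fun x => twistHom s η (sl2Upper K x)) (((s ^ 2 : Kˣ) : K) • X) := by
  simp only [twistHom_apply, sl2Diag_conj_upper]
  exact h.comp_mul _

lemma twistHom_lower_deriv {Y : Matrix (Fin n) (Fin n) K}
    (h : HasDerivAtZero (fun x => η (sl2Lower K x)) Y) (s : Kˣ) :
    HasDerivAtZero (fun x => twistHom s η (sl2Lower K x)) ((((s ^ 2)⁻¹ : Kˣ) : K) • Y) := by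
  simp only [twistHom_apply, sl2Diag_conj_lower]
  exact h.comp_mul _

/-- Conjugation by `diag(s, s⁻¹)` fixes the diagonal torus and scales the upper and lower root
vectors by `s²` and `s⁻²`. -/
lemma IsPinnedHom.twist (hη : IsPinnedHom spl D α η) (c : InvariantFamily spl.T) {s : Kˣ}
    (hs : s ^ 2 = c.c α.1) : IsPinnedHom (spl.smul c) D α (twistHom s η) where
  mem g := hη.mem _
  regular i j := sl2Functions_conj (sl2Diag s) (hη.regular i j)
  diag a := by rw [twistHom_apply, sl2Diag_conj_diag]; exact hη.diag a
  deriv_upper := by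
    have h := twistHom_upper_deriv hη.deriv_upper s
    rw [hs] at h
    exact h
  deriv_lower := by
    obtain ⟨Y, hY, hd⟩ := hη.deriv_lower
    exact ⟨_, hY.smul _, twistHom_lower_deriv hd s⟩

/-- The reverse passage, for an arbitrary homomorphism pinned by `c · spl`; it avoids any appeal to
uniqueness of pinned homomorphisms. -/
lemma IsPinnedHom.untwist {c : InvariantFamily spl.T} (hη : IsPinnedHom (spl.smul c) D α η)
    {s : Kˣ} (hs : s ^ 2 = (c.c α.1)⁻¹) : IsPinnedHom spl D α (twistHom s η) where
  mem g := hη.mem _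
  regular i j := sl2Functions_conj (sl2Diag s) (hη.regular i j)
  diag a := by rw [twistHom_apply, sl2Diag_conj_diag]; exact hη.diag a
  deriv_upper := by
    have h := twistHom_upper_deriv hη.deriv_upper s
    rw [hs] at h
    change HasDerivAtZero _ (((c.c α.1)⁻¹ : Kˣ) • ((c.c α.1 : Kˣ) • spl.X α)) at h
    rwa [inv_smul_smul] at h
  deriv_lower := by
    obtain ⟨Y, hY, hd⟩ := hη.deriv_lower
    exact ⟨_, hY.smul _, twistHom_lower_deriv hd s⟩

lemma twistHom_weyl (s : Kˣ) :
    twistHom s η (sl2Weyl K) = η (sl2Diag (s ^ 2)) * η (sl2Weyl K) := by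
  rw [twistHom_apply, sl2Diag_conj_weyl, map_mul]

lemma exists_unit_sq [IsAlgClosed K] (a : Kˣ) : ∃ s : Kˣ, s ^ 2 = a := by
  obtain ⟨z, hz⟩ := IsAlgClosed.exists_pow_nat_eq (a : K) zero_lt_two
  have hz0 : z ≠ 0 := by
    rintro rfl
    exact a.ne_zero (by simpa using hz.symm)
  exact ⟨Units.mk0 z hz0, Units.ext hz⟩

end Twist

/-! ### Products over inversions and Tits lifts -/

section Product

variable {F K : Type*} [Field F] [Field K] [Algebra F K] {n : ℕ} {G : ReductiveGroup F K n}

lemma inversionProd_eq {T : MaximalTorus G} {B : Subgroup (GL (Fin n) K)}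
    (D : BasedRootDatum T B) (w : CharLat T ≃ₗ[ℤ] CharLat T) (a : Root G T → Kˣ) :
    inversionProd D w a =
      ∏ᶠ (α : Root G T) (_ : α ∈ inversions D.base w), CocharLat.val (D.P.coroot α) (a α) := by
  refine finprod_congr fun α => finprod_congr_Prop ?_ fun _ => rfl
  refine propext ?_
  simp only [inversions, Set.mem_ofPred_eq, D.isPositive_iff, isPos_iff_mem_closure, D.root_eq]

/-- Finiteness of the root set is essential here: `finprod` takes the default value `1` on infinite
support and need not be multiplicative. -/
lemma inversionProd_mul {T : MaximalTorus G} {B : Subgroup (GL (Fin n) K)}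
    (D : BasedRootDatum T B) (w : CharLat T ≃ₗ[ℤ] CharLat T) (a a' : Root G T → Kˣ) :
    inversionProd D w (a * a') = inversionProd D w a * inversionProd D w a' := by
  have := finite_root T
  rw [inversionProd_eq, inversionProd_eq, inversionProd_eq,
    ← finprod_mem_mul_distrib (Set.toFinite _)]
  exact finprod_mem_congr rfl fun α _ => map_mul (D.P.coroot α).toMul.1 _ _

variable {spl : FSplitting G} {D : BasedRootDatum spl.T spl.B}

lemma InvariantFamily.reflectionPerm [CharZero K] (c : InvariantFamily spl.T)
    {α : SimpleRoot spl.T spl.B} {η : SL(2, K) →* GL (Fin n) K} (hη : IsPinnedHom spl D α η)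
    (β : Root G spl.T) : c.c (D.P.reflectionPerm α.1 β) = c.c β := by
  rw [← hη.conj_root β]
  exact c.weyl _ _ _ _

/-- The core computation, by induction on the reduced word: the inversion product of the tail is
conjugated past the first `n(s_α)`, which relabels it by `s_α`, and the new factor at `α` completes
the inversion product of the whole word. -/
lemma prod_coroot_mul_weyl [CharZero K] (c : InvariantFamily spl.T)
    {η : SimpleRoot spl.T spl.B → SL(2, K) →* GL (Fin n) K}
    (hη : ∀ α, IsPinnedHom spl D α (η α)) (l : List (SimpleRoot spl.T spl.B))
    (hl : IsShortest D.P (fun α : SimpleRoot spl.T spl.B => α.1) l) :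
    (l.map fun α => (CocharLat.val (D.P.coroot α.1) (c.c α.1) : GL (Fin n) K) *
      η α (sl2Weyl K)).prod =
    (inversionProd D (wordProd D l) c.c : GL (Fin n) K) *
      (l.map fun α => η α (sl2Weyl K)).prod := by
  have := finite_root spl.T
  have hf : ∀ α : SimpleRoot spl.T spl.B, α.1 ∈ D.base.support :=
    fun α => (D.mem_support_iff α.1).2 α.2
  induction l with
  | nil =>
    rw [inversionProd_eq]
    simp [wordProd, inversions_one]
  | cons α t ih =>
    have hinv : inversionProd D (wordProd D (α :: t)) c.c =
        CocharLat.val (D.P.coroot α.1) (c.c α.1) *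
          -- `conjHom` conjugates by the inverse of its element, so `symm` gives `t ↦ n t n⁻¹`.
          conjHom _ (hη α).weyl_conjugates.symm (inversionProd D (wordProd D t) c.c) := by
      rw [inversionProd_eq, inversionProd_eq, wordProd, inversions_cons D.base hf hl,
        finprod_mem_insert _ (notMem_image_inversions D.base (hf α) _) (Set.toFinite _),
        finprod_mem_image (D.P.reflectionPerm α.1).injective.injOn,
        MonoidHom.map_finprod_mem _ _ (Set.toFinite _)]
      congr 1
      refine finprod_mem_congr rfl fun β _ => Subtype.ext ?_
      rw [c.reflectionPerm (hη α), ← (hη α).weyl_conj_coroot]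
      change _ = (η α (sl2Weyl K))⁻¹⁻¹ * _ * (η α (sl2Weyl K))⁻¹
      rw [inv_inv]
    rw [List.map_cons, List.prod_cons, List.map_cons, List.prod_cons, ih hl.tail, hinv]
    change _ = (CocharLat.val (D.P.coroot α.1) (c.c α.1) : GL (Fin n) K) *
      ((η α (sl2Weyl K))⁻¹⁻¹ * _ * (η α (sl2Weyl K))⁻¹) * _
    simp [mul_assoc]

lemma IsTitsLift.smul [CharZero K] [IsAlgClosed K] {w : CharLat spl.T ≃ₗ[ℤ] CharLat spl.T}
    {g : GL (Fin n) K} (h : IsTitsLift spl D w g) (c : InvariantFamily spl.T) :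
    IsTitsLift (spl.smul c) D w ((inversionProd D w c.c : GL (Fin n) K) * g) := by
  obtain ⟨η, l, hη, ⟨rfl, hl⟩, rfl⟩ := h
  choose s hs using fun α : SimpleRoot spl.T spl.B => exists_unit_sq (c.c α.1)
  refine ⟨fun α => twistHom (s α) (η α), l, fun α => (hη α).twist c (hs α), ⟨rfl, hl⟩, ?_⟩
  rw [← prod_coroot_mul_weyl c hη l hl]
  refine congrArg List.prod (List.map_congr_left fun α _ => ?_)
  rw [← (hη α).diag, ← hs α]
  exact (twistHom_weyl _).symm

/-- Untwisting the chosen homomorphisms keeps the same word, which is reduced for either splitting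
because `T`, `B` and `D` do not change. -/
lemma IsTitsLift.exists_of_smul [CharZero K] [IsAlgClosed K] {c : InvariantFamily spl.T}
    {w : CharLat spl.T ≃ₗ[ℤ] CharLat spl.T} {g : GL (Fin n) K}
    (h : IsTitsLift (spl.smul c) D w g) :
    ∃ g', IsTitsLift spl D w g' ∧ g = (inversionProd D w c.c : GL (Fin n) K) * g' := by
  obtain ⟨η, l, hη, ⟨rfl, hl⟩, rfl⟩ := h
  choose s hs using fun α : SimpleRoot spl.T spl.B => exists_unit_sq (c.c α.1)⁻¹
  have hη' : ∀ α, IsPinnedHom spl D α (twistHom (s α) (η α)) := fun α => (hη α).untwist (hs α)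
  refine ⟨_, ⟨fun α => twistHom (s α) (η α), l, hη', ⟨rfl, hl⟩, rfl⟩, ?_⟩
  refine Eq.trans ?_ (prod_coroot_mul_weyl c hη' l hl)
  refine congrArg List.prod (List.map_congr_left fun α _ => ?_)
  have h1 : η α (sl2Diag (s α ^ 2)) =
      ((CocharLat.val (D.P.coroot α.1) (c.c α.1) : spl.T.carrier) : GL (Fin n) K)⁻¹ := by
    refine (congrArg (fun a => η α (sl2Diag a)) (hs α)).trans (((hη α).diag _).trans ?_)
    exact congrArg Subtype.val (map_inv (D.P.coroot α.1).toMul.1 _)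
  rw [twistHom_weyl, h1, mul_inv_cancel_left]

end Product

/-- The transported family takes the value `c_α` at `Ad(h) α`, so the factor from `c · A` is the one
by which the Tits lift changes. -/
lemma inversionProd_transport {F K : Type*} [Field F] [Field K] [Algebra F K] {n : ℕ}
    {G : ReductiveGroup F K n} {T : MaximalTorus G} {B : Subgroup (GL (Fin n) K)}
    (D : BasedRootDatum T B) (w : CharLat T ≃ₗ[ℤ] CharLat T) (c : InvariantFamily T)
    (S : MaximalTorus G) (A : Root G S → Kˣ) (h : GL (Fin n) K) (hG : h ∈ G.carrier)
    (hS : Conjugates h T.carrier S.carrier) :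
    inversionProd D w (fun α => (c.transport S * A) (Root.conj α h hG hS)) =
      inversionProd D w (fun α => A (Root.conj α h hG hS)) * inversionProd D w c.c := by
  rw [← inversionProd_mul]
  congr 1
  funext α
  rw [Pi.mul_apply, Pi.mul_apply, c.transport_conj, mul_comm]

end SplInv

end

theorem mainTheorem10 {F K : Type*} [Field F] [CharZero F] [Field K] [Algebra F K]
    [IsAlgClosure F K] {n : ℕ} (G : SplInv.ReductiveGroup F K n) (spl : SplInv.FSplitting G)
    (c : SplInv.InvariantFamily spl.T) (S : SplInv.MaximalTorus G)
    (A : SplInv.Root G S → Kˣ) (hA : SplInv.IsAData S A) (x : SplInv.H1 S) :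
    SplInv.IsSplittingInvariant S A (spl.smul c) x ↔
      SplInv.IsSplittingInvariant S (c.transport S * A) spl x := by
  have : IsAlgClosed K := IsAlgClosure.isAlgClosed F
  have : CharZero K := charZero_of_injective_algebraMap (algebraMap F K).injective
  constructor
  · rintro ⟨D, BS, h, hG, hS, z, h1, h2, h3, h4, hz⟩
    -- All the choices are kept; only the factor `∏ α^∨(c_α)` moves from the Tits lift to the
    -- `a`-data product.
    refine ⟨D, BS, h, hG, hS, z, h1, h2, h3, h4, fun σ => ?_⟩
    obtain ⟨w, g, hw, hg, hzσ⟩ := hz σ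
    obtain ⟨g', hg', rfl⟩ := SplInv.IsTitsLift.exists_of_smul (spl := spl) (D := D) hg
    refine ⟨w, g', hw, hg', hzσ.trans ?_⟩
    have key := SplInv.inversionProd_transport (T := spl.T) (B := spl.B) D w c S A h hG hS
    refine Eq.trans ?_ (congrArg (fun t : spl.T.carrier =>
      (t : GL (Fin n) K) * g' * (SplInv.gal σ h⁻¹ * h)) key.symm)
    exact congrArg (· * _) (mul_assoc _ _ _).symm
  · rintro ⟨D, BS, h, hG, hS, z, h1, h2, h3, h4, hz⟩
    refine ⟨D, BS, h, hG, hS, z, h1, h2, h3, h4, fun σ => ?_⟩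
    obtain ⟨w, g, hw, hg, hzσ⟩ := hz σ
    refine ⟨w, _, hw, hg.smul c, hzσ.trans ?_⟩
    rw [SplInv.inversionProd_transport, Subgroup.coe_mul, mul_assoc _ _ g]
    rfl
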